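/- Topological search maintains a topological order of a directed graph on a fixed set of $n$ vertices, initially without arcs, under arc additions. The order is stored in arrays $\mathit{position}$ (from the vertices to $\{1,\dots,n\}$) and $\mathit{vertex}$ (its inverse), with an arbitrary initial numbering, and the graph in an adjacency matrix $A$. When an arc $(v,w)$ is added, $A(v,w)$ is set to $1$. If $\mathit{position}(v)<\mathit{position}(w)$ nothing else is done. Otherwise the algorithm does the following. *Search.* Let $F=[w]$ and $B=[v]$ be queues, $i=\mathit{position}(w)$, $j=\mathit{position}(v)$, and set $\mathit{vertex}(i)=\mathit{vertex}(j)=\mathrm{null}$. Repeat the following two phases: (1) $i\leftarrow i+1$; while $i<j$ and $A(u,\mathit{vertex}(i))=0$ for all $u\in F$, do $i\leftarrow i+1$; if $i=j$ stop the search, otherwise add $\mathit{vertex}(i)$ to the back of $F$ and set $\mathit{vertex}(i)=\mathrm{null}$; (2) $j\leftarrow j-1$; while $i<j$ and $A(\mathit{vertex}(j),z)=0$ for all $z\in B$, do $j\leftarrow j-1$; if $i=j$ stop the search, otherwise add $\mathit{vertex}(j)$ to the back of $B$ and set $\mathit{vertex}(j)=\mathrm{null}$. *Cycle test.* If there is an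 arc $(u,z)$ with $u\in F$, $z\in B$, report a cycle and stop the algorithm. *Reordering.* While $F\neq[\,]$: if $\mathit{vertex}(i)\ne\mathrm{null}$ and some $u\in F$ has $A(u,\mathit{vertex}(i))=1$, add $\mathit{vertex}(i)$ to the back of $F$ and set $\mathit{vertex}(i)=\mathrm{null}$; then, if $\mathit{vertex}(i)=\mathrm{null}$, remove the front element $x$ of $F$ and set $\mathit{vertex}(i)=x$, $\mathit{position}(x)=i$; then $i\leftarrow i+1$. After that, while $B\neq[\,]$: $j\leftarrow j-1$; if $\mathit{vertex}(j)\ne\mathrm{null}$ and some $z\in B$ has $A(\mathit{vertex}(j),z)=1$, add $\mathit{vertex}(j)$ to the back of $B$ and set $\mathit{vertex}(j)=\mathrm{null}$; then, if $\mathit{vertex}(j)=\mathrm{null}$, remove the front element $y$ of $B$ and set $\mathit{vertex}(j)=y$, $\mathit{position}(y)=j$. Time is counted on a unit-cost random access machine: each assignment, comparison, queue operation and matrix lookup takes one unit. A test over a queue does one lookup per queue element, from the front, until its outcome is known; the cycle test looks up the pairs in $F\times B$ one by one until an arc is found. The time of a sequence of arc additions is the total over the additions; the initialization is not counted. **Corollary.**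 There is a constant $c>0$ such that for every $n\ge 2$ and every initial numbering of $n$ vertices there is a sequence of additions of distinct arcs, which together form an acyclic graph, on which topological search takes at least $c\,n^2\,2^{\sqrt{2\lg n}}$ time, where $\lg$ is the logarithm to base $2$. -/

import Mathlib

namespace TopSearch

/-! Topological search for incremental topological ordering, with its running time.

Every procedure returns its result together with its running time on a unit-cost random access
machine: one unit for every assignment (to a variable or to an array entry), every comparison,
every queue operation and every lookup in the adjacency matrix.  Queues are lists with the front
at the head.  Positions run from `1` to `n`; an entry of the array `vertex` that equals `none` is
null. -/

variable {V : Type}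

/-- Is there `u` in the queue with `p u`?  The queue is scanned from its front, with one lookup for
each element, and the scan ends with the first success. -/
def scan (p : V → Bool) : List V → Bool × ℕ
  | [] => (false, 0)
  | u :: Q => if p u then (true, 1) else ((scan p Q).1, (scan p Q).2 + 1)

/-- `while i < j and ∀ u ∈ F (A(u, vertex(i)) = 0) do i = i + 1`; the result is the final `i`. -/
def forwardScan (A : V → V → Bool) (vertex : ℕ → Option V) (F : List V) (i j : ℕ) : ℕ × ℕ :=
  if i < j then
    let t := scan (fun u => (vertex i).any fun x => A u x) F
    if t.1 then (i, 1 + t.2)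
    else
      let r := forwardScan A vertex F (i + 1) j
      (r.1, 1 + t.2 + 1 + r.2)
  else (i, 1)
termination_by j - i

/-- `while i < j and ∀ z ∈ B (A(vertex(j), z) = 0) do j = j - 1`; the result is the final `j`. -/
def backwardScan (A : V → V → Bool) (vertex : ℕ → Option V) (B : List V) (i j : ℕ) : ℕ × ℕ :=
  if i < j then
    let t := scan (fun z => (vertex j).any fun x => A x z) B
    if t.1 then (j, 1 + t.2)
    else
      let r := backwardScan A vertex B i (j - 1)
      (r.1, 1 + t.2 + 1 + r.2)
  else (j, 1)
termination_by j - i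

theorem le_forwardScan (A : V → V → Bool) (vertex : ℕ → Option V) (F : List V) (i j : ℕ) :
    i ≤ (forwardScan A vertex F i j).1 := by
  fun_induction forwardScan A vertex F i j <;> grind

theorem backwardScan_le (A : V → V → Bool) (vertex : ℕ → Option V) (B : List V) (i j : ℕ) :
    (backwardScan A vertex B i j).1 ≤ j := by
  fun_induction backwardScan A vertex B i j <;> grind

/-- The two queues, the array `vertex` and the current positions of the two-way search. -/
structure SearchState (V : Type) where
  F : List V
  B : List V
  vertex : ℕ → Option V
  i : ℕ
  j : ℕ

/-- The main loop of the search, which alternates between adding a vertex to `F` and adding a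
vertex to `B`.  It is entered with `i < j`, and `i ≤ j` holds throughout, so that the tests
`i < j` below fail exactly if `i = j`. -/
def searchLoop (A : V → V → Bool) (F B : List V) (vertex : ℕ → Option V) (i j : ℕ) :
    SearchState V × ℕ :=
  -- `i = i + 1`, then the forward scan
  let f := forwardScan A vertex F (i + 1) j
  if f.1 < j then
    -- `inject(vertex(i), F); vertex(i) = null`
    let F₁ := F ++ (vertex f.1).toList
    let vertex₁ := Function.update vertex f.1 none
    -- `j = j - 1`, then the backward scan
    let b := backwardScan A vertex₁ B f.1 (j - 1)
    if f.1 < b.1 then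
      -- `inject(vertex(j), B); vertex(j) = null`
      let B₁ := B ++ (vertex₁ b.1).toList
      let vertex₂ := Function.update vertex₁ b.1 none
      let r := searchLoop A F₁ B₁ vertex₂ f.1 b.1
      (r.1, (1 + f.2 + 1 + 2) + (1 + b.2 + 1 + 2) + r.2)
    else (⟨F₁, B, vertex₁, f.1, b.1⟩, (1 + f.2 + 1 + 2) + (1 + b.2 + 1))
  else (⟨F, B, vertex, f.1, j⟩, 1 + f.2 + 1)
termination_by j - i
decreasing_by
  have h1 := le_forwardScan A vertex F (i + 1) j
  have h2 := backwardScan_le A (Function.update vertex (forwardScan A vertex F (i + 1) j).1 none) B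
    (forwardScan A vertex F (i + 1) j).1 (j - 1)
  grind

/-- The arrays `vertex` and `position` that represent the current topological order. -/
structure Order (V : Type) where
  vertex : ℕ → Option V
  position : V → ℕ

/-- The search that is triggered by a new arc `(v, w)` with `position(w) < position(v)`. -/
def search (A : V → V → Bool) (o : Order V) (v w : V) : SearchState V × ℕ :=
  let i := o.position w
  let j := o.position v
  let r := searchLoop A [w] [v] (Function.update (Function.update o.vertex i none) j none) i j
  (r.1, 8 + r.2)

/-- Is there an arc from the queue `F` to the queue `B`?  The pairs are tested one by one until an
arc is found. -/
def cycleTest (A : V → V → Bool) (B : List V) : List V → Bool × ℕ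
  | [] => (false, 0)
  | u :: F =>
    let t := scan (A u) B
    if t.1 then (true, t.2) else ((cycleTest A B F).1, t.2 + (cycleTest A B F).2)

section Reorder

variable [DecidableEq V]

/-- The part of the reordering loops that fills position `i` of the order: if `vertex(i)` is null,
pop the front `x` of the queue `Q`, and set `vertex(i) = x`, `position(x) = i`. -/
def refill (Q : List V) (o : Order V) (i : ℕ) : (List V × Order V) × ℕ :=
  match o.vertex i, Q with
  | none, x :: Q' =>
    ((Q', ⟨Function.update o.vertex i (some x), Function.update o.position x i⟩), 1 + 3)
  | _, _ => ((Q, o), 1)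

/-- The forward loop of the reordering, `while F ≠ [] do ...`, from position `i`.  (The array ends
at `n`; the loop empties `F` before it leaves the array.) -/
def reorderForward (n : ℕ) (A : V → V → Bool) (F : List V) (o : Order V) (i : ℕ) :
    Order V × ℕ :=
  if F ≠ [] ∧ i ≤ n then
    let t := scan (fun u => (o.vertex i).any fun x => A u x) (if (o.vertex i).isSome then F else [])
    let s : (List V × Order V) × ℕ :=
      if t.1 then
        refill (F ++ (o.vertex i).toList) ⟨Function.update o.vertex i none, o.position⟩ i
      else refill F o i
    let r := reorderForward n A s.1.1 s.1.2 (i + 1)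
    (r.1, 1 + (1 + t.2) + (if t.1 then 2 else 0) + s.2 + 1 + r.2)
  else (o, 1)
termination_by n + 1 - i

/-- The backward loop of the reordering, `while B ≠ [] do ...`, from position `j - 1` downward.
(The loop empties `B` before it leaves the array.) -/
def reorderBackward (A : V → V → Bool) (B : List V) (o : Order V) (j : ℕ) : Order V × ℕ :=
  if B ≠ [] ∧ 1 < j then
    let t := scan (fun z => (o.vertex (j - 1)).any fun x => A x z)
      (if (o.vertex (j - 1)).isSome then B else [])
    let s : (List V × Order V) × ℕ :=
      if t.1 then
        refill (B ++ (o.vertex (j - 1)).toList)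
          ⟨Function.update o.vertex (j - 1) none, o.position⟩ (j - 1)
      else refill B o (j - 1)
    let r := reorderBackward A s.1.1 s.1.2 (j - 1)
    (r.1, 1 + 1 + (1 + t.2) + (if t.1 then 2 else 0) + s.2 + r.2)
  else (o, 1)
termination_by j

/-- Addition of the arc `(v, w)` to the graph with adjacency matrix `A` and order `o`.  The result
is `none` if a cycle is reported, and the new matrix and order otherwise. -/
def addArc (n : ℕ) (A : V → V → Bool) (o : Order V) (v w : V) :
    Option ((V → V → Bool) × Order V) × ℕ :=
  let A' : V → V → Bool := fun x y => A x y || (decide (x = v) && decide (y = w))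
  if o.position w < o.position v then
    let s := search A' o v w
    let c := cycleTest A' s.1.B s.1.F
    if c.1 then (none, 2 + s.2 + c.2)
    else
      let f := reorderForward n A' s.1.F ⟨s.1.vertex, o.position⟩ s.1.i
      let b := reorderBackward A' s.1.B f.1 s.1.j
      (some (A', b.1), 2 + s.2 + c.2 + f.2 + b.2)
  else (some (A', o), 2)

/-- Total time for a sequence of arc additions, starting from a given graph and order.  The
algorithm stops if it reports a cycle. -/
def timeFrom (n : ℕ) (A : V → V → Bool) (o : Order V) : List (V × V) → ℕ
  | [] => 0
  | a :: arcs =>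
    let r := addArc n A o a.1 a.2
    match r.1 with
    | none => r.2
    | some s => r.2 + timeFrom n s.1 s.2 arcs

end Reorder

/-- The order in which vertex `v` has position `σ v + 1`, so that the positions are `1, …, n`. -/
def initialOrder {n : ℕ} (σ : Equiv.Perm (Fin n)) : Order (Fin n) where
  vertex i := if h : 1 ≤ i ∧ i ≤ n then some (σ.symm ⟨i - 1, by omega⟩) else none
  position v := (σ v : ℕ) + 1

/-- The time that topological search takes on a sequence of arc additions to the graph with vertex
set `Fin n` and no arcs, if the initial numbering of the vertices is `σ`. -/
def time {n : ℕ} (σ : Equiv.Perm (Fin n)) (arcs : List (Fin n × Fin n)) : ℕ :=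
  timeFrom n (fun _ _ => false) (initialOrder σ) arcs

/-- No arc is repeated, and the graph formed by all the arcs has no cycle (in particular no
loop). -/
def IsAcyclicSequence (arcs : List (V × V)) : Prop :=
  arcs.Nodup ∧ ∀ v, ¬ Relation.TransGen (fun x y => (x, y) ∈ arcs) v v

end TopSearch

/-! Keep `2 * H` vertices as items and leave `K` other vertices, without arcs, between the first `H`
and the last `H` items. If the items labelled `a < b` are neighbours in this order, the arc from the
item of `b` to that of `a` just exchanges them. If they are the two items around the middle, the
search must also scan all `K` vertices between them. All arcs go from larger to smaller labels, so
the graph stays acyclic. It remains to find a sequence of order-inverting adjacent swaps on `2 * H`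
entries with many swaps at the median (`MedianRun`).

Such runs are built recursively. Replace every entry by a bundle of `N` entries. A swap away from
the median becomes an exchange of whole bundles on one side of it. Exchanging two bundles across the
median forces `N` swaps there between entries of different bundles. Meanwhile each bundle performs
one round of odd-even transposition, whose swaps are also made at the median; this adds `N - 1`
more, for a total of `2 * N - 1` (`MedianRun.exchange_bundle`). A bundle can afford `N` rounds, so
`N` must bound how often an entry meets the median. In one exchange an entry takes part in one or
three median swaps, but only two on average, so this bound doubles at each level (`MedianRun.lift`,
`HasMedianRun.mul`).

Hence the bundle sizes can be 2, 4, 8, …. After `i` levels `H = 2 ^ triangle i`, and the number of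
median swaps per item has nearly doubled each time, to order `2 ^ i` (`exists_hasMedianRun`). Since
`triangle i` is about `i ^ 2 / 2`, `i` is about `√(2 * lg H)`. One last level, with bundles chosen
so that both `H` and `K` are proportional to `n`, gives time of order `n ^ 2 * 2 ^ i`
(`exists_le_time`). -/

namespace TopSearch

/-! ### Runs of adjacent swaps, counted at the median -/

/-- `MedianRun H l l' r m`: the list `l` can be transformed into `l'` by swaps of adjacent entries
`a, b` with `a < b`, of which `m` exchange the entries number `H` and `H + 1`; the entry `x` takes
part in `r x` of these `m` swaps. -/
inductive MedianRun (H : ℕ) : List ℕ → List ℕ → (ℕ → ℕ) → ℕ → Prop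
  | refl (l : List ℕ) : MedianRun H l l 0 0
  | side {l₁ l₂ l' : List ℕ} {a b : ℕ} {r : ℕ → ℕ} {m : ℕ} (hab : a < b)
      (hl : l₁.length + 1 ≠ H) (h : MedianRun H (l₁ ++ b :: a :: l₂) l' r m) :
      MedianRun H (l₁ ++ a :: b :: l₂) l' r m
  | mid {l₁ l₂ l' : List ℕ} {a b : ℕ} {r : ℕ → ℕ} {m : ℕ} (hab : a < b)
      (hl : l₁.length + 1 = H) (h : MedianRun H (l₁ ++ b :: a :: l₂) l' r m) :
      MedianRun H (l₁ ++ a :: b :: l₂) l' (Pi.single a 1 + Pi.single b 1 + r) (1 + m)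

namespace MedianRun

variable {H : ℕ}

theorem trans {l l' l'' : List ℕ} {r r' : ℕ → ℕ} {m m' : ℕ} (h : MedianRun H l l' r m)
    (h' : MedianRun H l' l'' r' m') : MedianRun H l l'' (r + r') (m + m') := by
  induction h with
  | refl l => simpa using h'
  | side hab hl _ ih => exact side hab hl (ih h')
  | mid hab hl _ ih => rw [add_assoc, add_assoc 1]; exact mid hab hl (ih h')

/-- Rearrangements on one side of the median can be prefixed at no charge to either counter. -/
theorem free_trans {l l' l'' : List ℕ} {r : ℕ → ℕ} {m : ℕ} (h : MedianRun H l l' 0 0)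
    (h' : MedianRun H l' l'' r m) : MedianRun H l l'' r m := by
  simpa using h.trans h'

/-- An entry moves to the right past a list of larger entries on one side of the median. -/
theorem move_right (a : ℕ) (Y l₁ l₂ : List ℕ) (hY : ∀ y ∈ Y, a < y)
    (hl : H ≤ l₁.length ∨ l₁.length + 1 + Y.length ≤ H) :
    MedianRun H (l₁ ++ a :: (Y ++ l₂)) (l₁ ++ (Y ++ a :: l₂)) 0 0 := by
  induction Y generalizing l₁ with
  | nil => exact refl _
  | cons y Y ih =>
    have hlen : (y :: Y).length = Y.length + 1 := rfl
    have := ih (l₁ ++ [y]) (fun z hz => hY z (by simp [hz])) (by simp; omega)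
    refine side (hY y (by simp)) (by omega) ?_
    simpa using this

/-- Two adjacent blocks are exchanged on one side of the median. -/
theorem swap_blocks (X Y l₁ l₂ : List ℕ) (hXY : ∀ x ∈ X, ∀ y ∈ Y, x < y)
    (hl : H ≤ l₁.length ∨ l₁.length + X.length + Y.length ≤ H) :
    MedianRun H (l₁ ++ (X ++ (Y ++ l₂))) (l₁ ++ (Y ++ (X ++ l₂))) 0 0 := by
  induction X generalizing l₁ with
  | nil => exact refl _
  | cons x X ih =>
    have hlen : (x :: X).length = X.length + 1 := rfl
    have h1 := ih (l₁ ++ [x]) (fun z hz => hXY z (by simp [hz])) (by simp; omega)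
    have h2 := move_right (H := H) x Y l₁ (X ++ l₂) (hXY x (by simp)) (by omega)
    simp only [List.append_assoc, List.cons_append, List.nil_append] at h1 h2 ⊢
    exact h1.free_trans h2

end MedianRun

theorem getElem?_swap {l₁ l₂ : List ℕ} {a b k x : ℕ} (h : (l₁ ++ b :: a :: l₂)[k]? = some x) :
    (k = l₁.length ∧ x = b) ∨ (k = l₁.length + 1 ∧ x = a) ∨
      (k ≠ l₁.length ∧ k ≠ l₁.length + 1 ∧ (l₁ ++ a :: b :: l₂)[k]? = some x) := by
  rcases Nat.lt_or_ge k l₁.length with hk | hk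
  · rw [List.getElem?_append_left hk] at h ⊢
    exact Or.inr (Or.inr ⟨by omega, by omega, h⟩)
  · obtain ⟨d, rfl⟩ := Nat.exists_eq_add_of_le hk
    rw [List.getElem?_append_right (by omega)] at h ⊢
    rcases d with _ | _ | d
    · simp at h; simp [h]
    · simp at h; simp [h]
    · refine Or.inr (Or.inr ⟨by omega, by omega, ?_⟩)
      simpa [show l₁.length + (d + 1 + 1) - l₁.length = d + 1 + 1 by omega] using h

/-! ### Exchange of two blocks across the median -/

/-- The entries of a list of pairs, in order. -/
def flat (ps : List (ℕ × ℕ)) : List ℕ := ps.flatMap fun p => [p.1, p.2]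

@[simp] theorem flat_nil : flat [] = [] := rfl

@[simp] theorem flat_cons (p : ℕ × ℕ) (ps : List (ℕ × ℕ)) :
    flat (p :: ps) = p.1 :: p.2 :: flat ps := rfl

@[simp] theorem flat_append (ps qs : List (ℕ × ℕ)) : flat (ps ++ qs) = flat ps ++ flat qs := by
  simp [flat]

@[simp] theorem length_flat (ps : List (ℕ × ℕ)) : (flat ps).length = 2 * ps.length := by
  induction ps with
  | nil => rfl
  | cons p ps ih => simp [ih]; omega

/-- Two adjacent blocks, `xs` just before the median and `y, ys, z` just after it, are exchanged.
On the way every pair in `xs` and in `ys` is swapped at the median. -/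
theorem MedianRun.exchange {H : ℕ} (ys xs : List (ℕ × ℕ)) (y z : ℕ) (l₁ l₂ Y X : List ℕ)
    (hlen : xs.length = ys.length + 1) (hH : l₁.length + (2 * xs.length + Y.length) = H)
    (hxs : ∀ p ∈ xs, p.1 < p.2) (hys : ∀ p ∈ ys, p.1 < p.2)
    (hxY : ∀ x ∈ flat xs, ∀ v ∈ Y, x < v) (hxy : ∀ x ∈ flat xs, x < y)
    (hxz : ∀ x ∈ flat xs, x < z) (hxys : ∀ x ∈ flat xs, ∀ v ∈ flat ys, x < v) :
    ∃ r m, MedianRun H (l₁ ++ (flat xs ++ (Y ++ (y :: (flat ys ++ z :: (X ++ l₂))))))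
      (l₁ ++ (Y ++ (y :: (flat (ys.map Prod.swap) ++ z ::
        (flat (xs.map Prod.swap) ++ (X ++ l₂)))))) r m ∧ m = 4 * ys.length + 3 ∧
      ∀ v, r v = (xs.map Prod.fst).count v + 3 * (xs.map Prod.snd).count v +
        3 * (ys.map Prod.fst).count v + (ys.map Prod.snd).count v + [y, z].count v := by
  induction ys generalizing xs y Y X with
  | nil =>
    obtain ⟨⟨b, b'⟩, rfl⟩ : ∃ p, xs = [p] := List.length_eq_one_iff.1 (by simpa using hlen)
    simp only [forall_eq, flat_cons, flat_nil, List.mem_cons, List.not_mem_nil,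
      or_false, forall_eq_or_imp, List.length_singleton] at *
    have h1 := swap_blocks (H := H) [b, b'] Y l₁ (y :: z :: (X ++ l₂))
      (by simpa using hxY) (by simp; omega)
    -- The run is assembled from its last swap backwards. With `|` for the median it reads `b b'|y
    -- z`, `b y|b' z`, `y b|b' z`, `y b'|b z`, `y b'|z b`, `y z|b' b`.
    have h2 : MedianRun H (((l₁ ++ Y) ++ [y]) ++ b' :: z :: b :: (X ++ l₂))
      (((l₁ ++ Y) ++ [y]) ++ z :: b' :: b :: (X ++ l₂)) _ _ :=
      mid hxz.2 (by simp; omega) (refl _)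
    have h3 : MedianRun H (((l₁ ++ Y) ++ [y, b']) ++ b :: z :: (X ++ l₂)) _ _ _ :=
      side hxz.1 (by simp; omega) (by simpa using h2)
    have h4 : MedianRun H (((l₁ ++ Y) ++ [y]) ++ b :: b' :: z :: (X ++ l₂)) _ _ _ :=
      mid hxs (by simp; omega) (by simpa using h3)
    have h5 : MedianRun H ((l₁ ++ Y) ++ b :: y :: b' :: z :: (X ++ l₂)) _ _ _ :=
      side hxy.1 (by simp; omega) (by simpa using h4)
    have h6 : MedianRun H (((l₁ ++ Y) ++ [b]) ++ b' :: y :: z :: (X ++ l₂)) _ _ _ :=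
      mid hxy.2 (by simp; omega) (by simpa using h5)
    have h7 := h1.free_trans (by simpa using h6)
    refine ⟨_, _, by simpa using h7, rfl, fun v => ?_⟩
    simp only [Pi.add_apply, Pi.single_apply, List.map_cons, List.map_nil,
      List.count_cons, List.count_nil, beq_iff_eq]
    simp only [@eq_comm ℕ v]
    omega
  | cons q ys ih =>
    obtain ⟨y₁, y₂⟩ := q
    obtain ⟨xs, ⟨b, b'⟩, rfl⟩ : ∃ xs' p, xs = xs' ++ [p] := by
      rcases List.eq_nil_or_concat xs with h | ⟨xs', p, h⟩
      · simp [h] at hlen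
      · exact ⟨xs', p, by simpa using h⟩
    simp only [List.length_append, List.length_nil, List.length_cons, zero_add,
      Nat.add_right_cancel_iff, List.mem_append, List.mem_cons, List.not_mem_nil, or_false,
      flat_append, flat_cons,
      flat_nil] at hlen hH hxs hys hxY hxy hxz hxys
    -- After the last pair of `xs` has crossed, `y` and `y₂` are on the left for good and `y₁`, just
    -- right of the median, takes over the role of `y`. `Y` and `X` collect the entries that have
    -- crossed.
    obtain ⟨r, m, hr, hm, hrv⟩ := ih xs y₁ (Y ++ [y, y₂]) ([b', b] ++ X) hlen (by simp; omega)
      (fun p hp => hxs p (Or.inl hp)) (fun p hp => hys p (Or.inr hp))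
      (by
        intro x hx v hv
        simp only [List.mem_append, List.mem_cons, List.not_mem_nil, or_false] at hv
        rcases hv with hv | rfl | rfl
        · exact hxY x (Or.inl hx) v hv
        · exact hxy x (Or.inl hx)
        · exact hxys x (Or.inl hx) _ (by simp))
      (fun x hx => hxys x (Or.inl hx) _ (by simp)) (fun x hx => hxz x (Or.inl hx))
      (fun x hx v hv => hxys x (Or.inl hx) v (by simp [hv]))
    have hb : ∀ v ∈ flat ys ++ [z], b < v ∧ b' < v := by
      intro v hv
      simp only [List.mem_append, List.mem_cons, List.not_mem_nil, or_false] at hv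
      rcases hv with hv | rfl
      · exact ⟨hxys b (by simp) v (by simp [hv]), hxys b' (by simp) v (by simp [hv])⟩
      · exact ⟨hxz b (by simp), hxz b' (by simp)⟩
    set l := l₁ ++ flat xs with hl
    have hllen : l.length = l₁.length + 2 * xs.length := by simp [hl]
    -- Again backwards. In forward order the median swaps are `b', y`, then `b, b'`, then `b', y₁`,
    -- then `y₁, y₂`: four for each pair of `ys`. Finally `b', b` move out of the way past the rest
    -- of the right block.
    have h0 := swap_blocks (H := H) [b', b] (flat ys ++ [z]) (l ++ (Y ++ [y, y₂, y₁])) (X ++ l₂)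
      (by
        intro x hx v hv
        simp only [List.mem_cons, List.not_mem_nil, or_false] at hx
        rcases hx with rfl | rfl
        · exact (hb v hv).2
        · exact (hb v hv).1) (by simp; omega)
    replace h0 := h0.free_trans (r := r) (m := m)
      (by simpa [hl, List.append_assoc] using hr)
    have h1 : MedianRun H ((l ++ Y ++ [y]) ++ y₁ :: y₂ :: b' :: b :: (flat ys ++ z :: (X ++ l₂)))
      _ _ _ := mid (hys (y₁, y₂) (by simp)) (by simp; omega)
        (by simpa [List.append_assoc] using h0)
    have h2 := swap_blocks (H := H) [b', b] [y₂] (l ++ Y ++ [y, y₁]) (flat ys ++ z :: (X ++ l₂))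
      (by
        have h1 := hxys b (by simp) y₂ (by simp)
        have h2 := hxys b' (by simp) y₂ (by simp)
        simp [h1, h2]) (by simp; omega)
    replace h2 := h2.free_trans (by simpa using h1)
    have h3 : MedianRun H ((l ++ Y ++ [y]) ++ b' :: y₁ :: b :: y₂ :: (flat ys ++ z :: (X ++ l₂)))
      _ _ _ := mid (hxys b' (by simp) y₁ (by simp)) (by simp; omega) (by simpa using h2)
    have h4 : MedianRun H ((l ++ Y ++ [y, b']) ++ b :: y₁ :: y₂ :: (flat ys ++ z :: (X ++ l₂)))
      _ _ _ := side (hxys b (by simp) y₁ (by simp)) (by simp; omega) (by simpa using h3)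
    have h5 : MedianRun H ((l ++ Y ++ [y]) ++ b :: b' :: y₁ :: y₂ :: (flat ys ++ z :: (X ++ l₂)))
      _ _ _ := mid (hxs (b, b') (by simp)) (by simp; omega) (by simpa using h4)
    have h6 : MedianRun H ((l ++ Y) ++ b :: y :: b' :: y₁ :: y₂ :: (flat ys ++ z :: (X ++ l₂)))
      _ _ _ := side (hxy b (by simp)) (by simp; omega) (by simpa using h5)
    have h7 : MedianRun H ((l ++ Y ++ [b]) ++ b' :: y :: y₁ :: y₂ :: (flat ys ++ z :: (X ++ l₂)))
      _ _ _ := mid (hxy b' (by simp)) (by simp; omega) (by simpa using h6)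
    have h8 := swap_blocks (H := H) [b, b'] Y l (y :: y₁ :: y₂ :: (flat ys ++ z :: (X ++ l₂)))
      (by
        intro x hx v hv
        simp only [List.mem_cons, List.not_mem_nil, or_false] at hx
        exact hxY x (by simp [hx]) v hv) (by simp; omega)
    replace h8 := h8.free_trans (by simpa using h7)
    refine ⟨_, _, by simpa [hl] using h8, by simp [hm]; omega, fun v => ?_⟩
    simp only [Pi.add_apply, Pi.single_apply, List.map_cons, List.map_append, List.map_nil, hrv,
      List.count_append, List.count_cons, List.count_nil, beq_iff_eq]
    simp only [@eq_comm ℕ v]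
    omega

/-! ### Odd-even transposition inside a bundle -/

/-- Entry number `p` after `s` rounds of odd-even transposition of the list `0, …, N - 1`, where
the round `s` swaps the entries `p, p + 1` with `p + s` even. -/
def label (N s p : ℕ) : ℕ :=
  if (p + s) % 2 = 0 then (if s ≤ p then p - s else s - p - 1)
  else (if p + s < N then p + s else 2 * N - 1 - p - s)

/-- The index of the entry `k` after `s` rounds of odd-even transposition. -/
def slot (N s k : ℕ) : ℕ :=
  if k % 2 = 0 then (if k + s < N then k + s else 2 * N - 1 - k - s)
  else (if s ≤ k then k - s else s - k - 1)

/-- Is the index of the entry `k` after `s` rounds even? -/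
def slotEven (N s k : ℕ) : ℕ := 1 - slot N s k % 2

theorem label_lt {N s p : ℕ} (hs : s ≤ N) (hp : p < N) : label N s p < N := by
  unfold label; split_ifs <;> omega

/-- Even entries walk to the right and odd ones to the left; each waits one round at the end of the
list and then turns back. Tracking entries by index and indices by entry are therefore inverse,
which makes labels distinct. -/
theorem slot_label {N s p : ℕ} (hs : s ≤ N) (hp : p < N) : slot N s (label N s p) = p := by
  unfold label; split_ifs <;> unfold slot <;> split_ifs <;> omega

theorem label_lt_label {N s p : ℕ} (hs : s < N) (hp : p + 1 < N) (h : (p + s) % 2 = 0) :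
    label N s p < label N s (p + 1) := by
  unfold label; split_ifs <;> omega

theorem label_succ_left {N s p : ℕ} (h : (p + s) % 2 = 0) :
    label N (s + 1) p = label N s (p + 1) := by
  unfold label; split_ifs <;> omega

theorem label_succ_right {N s p : ℕ} (h : (p + s) % 2 = 0) :
    label N (s + 1) (p + 1) = label N s p := by
  unfold label; split_ifs <;> omega

theorem label_succ_zero {N s : ℕ} (hs : s < N) (h : s % 2 = 1) :
    label N (s + 1) 0 = label N s 0 := by
  unfold label; split_ifs <;> omega

theorem label_succ_last {M s : ℕ} (hs : s < 2 * (M + 1)) (h : s % 2 = 1) :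
    label (2 * (M + 1)) (s + 1) (2 * M + 1) = label (2 * (M + 1)) s (2 * M + 1) := by
  unfold label; split_ifs <;> omega

theorem slotEven_le (N s k : ℕ) : slotEven N s k ≤ 1 := by unfold slotEven; omega

/-- `slotEven` is the potential that amortizes median swaps. In an even round every index has a
partner, so every entry changes parity. -/
theorem slotEven_succ_of_even {M s k : ℕ} (hs : s < 2 * (M + 1)) (hk : k < 2 * (M + 1))
    (h : s % 2 = 0) : slotEven (2 * (M + 1)) (s + 1) k = 1 - slotEven (2 * (M + 1)) s k := by
  unfold slotEven slot; split_ifs <;> omega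

/-- In an odd round only the two end indices have no partner. The entries at the other odd indices
are those with three median swaps, so these are the ones whose potential must rise. -/
theorem slotEven_succ_of_odd {M s k : ℕ} (h : s % 2 = 1) (h1 : slot (2 * (M + 1)) s k % 2 = 1)
    (h2 : slot (2 * (M + 1)) s k ≠ 2 * M + 1) : slotEven (2 * (M + 1)) (s + 1) k = 1 := by
  unfold slotEven; unfold slot at *; split_ifs at * <;> omega

/-- The `N` entries that replace the entry `x`, in the order after `s` rounds. -/
def bundle (N s x : ℕ) : List ℕ := (List.range N).map fun p => x * N + label N s p

@[simp] theorem length_bundle (N s x : ℕ) : (bundle N s x).length = N := by simp [bundle]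

theorem lt_of_mem_bundle {N s t a b v w : ℕ} (hs : s ≤ N) (hab : a < b)
    (hv : v ∈ bundle N s a) (hw : w ∈ bundle N t b) : v < w := by
  simp only [bundle, List.mem_map, List.mem_range] at hv hw
  obtain ⟨p, hp, rfl⟩ := hv
  obtain ⟨q, hq, rfl⟩ := hw
  have h1 := label_lt hs hp
  have h2 : (a + 1) * N ≤ b * N := Nat.mul_le_mul_right _ hab
  rw [add_mul, one_mul] at h2
  omega

theorem map_range_two_mul (f : ℕ → ℕ) (M : ℕ) :
    (List.range (2 * M)).map f = flat ((List.range M).map fun j => (f (2 * j), f (2 * j + 1))) := by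
  induction M with
  | zero => rfl
  | succ M ih =>
    rw [show 2 * (M + 1) = 2 * M + 1 + 1 by ring, List.range_succ, List.range_succ,
      List.range_succ]
    simp [ih]

theorem map_range_two_mul_succ (f : ℕ → ℕ) (M : ℕ) : (List.range (2 * (M + 1))).map f =
    f 0 :: (flat ((List.range M).map fun j => (f (2 * j + 1), f (2 * j + 2))) ++
      [f (2 * M + 1)]) := by
  induction M with
  | zero => rfl
  | succ M ih =>
    rw [show 2 * (M + 1 + 1) = 2 * (M + 1) + 1 + 1 by ring, List.range_succ, List.range_succ,
      List.map_append, List.map_append, ih, List.range_succ]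
    simp [mul_add]

/-- An entry `v` encodes its bundle as `v / N` and its label there as `v % N`. This turns the counts
in `MedianRun.exchange` into conditions on the index of `v`. -/
theorem count_map_label {N s x M : ℕ} {g : ℕ → ℕ} (v : ℕ) (hs : s ≤ N) (hg : ∀ j < M, g j < N)
    (hinj : g.Injective) :
    ((List.range M).map fun j => x * N + label N s (g j)).count v = 0 ∨
    ((List.range M).map fun j => x * N + label N s (g j)).count v = 1 ∧ v / N = x ∧
      ∃ j < M, slot N s (v % N) = g j := by
  set l := (List.range M).map fun j => x * N + label N s (g j) with hl
  by_cases hv : v ∈ l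
  · right
    refine ⟨List.count_eq_one_of_mem ?_ hv, ?_⟩
    · refine List.Nodup.map_on ?_ List.nodup_range
      intro i hi j hj hij
      rw [List.mem_range] at hi hj
      have := congrArg (slot N s) (Nat.add_left_cancel hij)
      rw [slot_label hs (hg i hi), slot_label hs (hg j hj)] at this
      exact hinj this
    · obtain ⟨j, hj, rfl⟩ := List.mem_map.1 hv
      rw [List.mem_range] at hj
      have h1 := label_lt hs (hg j hj)
      have hN : 0 < N := by omega
      rw [mul_comm, Nat.mul_add_div hN, Nat.div_eq_of_lt h1, Nat.mul_add_mod, Nat.mod_eq_of_lt h1,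
        slot_label hs (hg j hj)]
      exact ⟨rfl, j, hj, rfl⟩
  · exact Or.inl (List.count_eq_zero_of_not_mem hv)

theorem count_label {N s x p : ℕ} (v : ℕ) (hs : s ≤ N) (hp : p < N) :
    [x * N + label N s p].count v = 0 ∨
    [x * N + label N s p].count v = 1 ∧ v / N = x ∧ slot N s (v % N) = p := by
  by_cases hv : v = x * N + label N s p
  · right
    subst hv
    have h1 := label_lt hs hp
    have hN : 0 < N := by omega
    rw [mul_comm, Nat.mul_add_div hN, Nat.div_eq_of_lt h1, Nat.mul_add_mod, Nat.mod_eq_of_lt h1,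
      slot_label hs hp]
    simp
  · exact Or.inl (List.count_eq_zero_of_not_mem (by simpa using hv))

/-- The exchange of two bundles at the median, with `2 N - 1` swaps at the median. -/
theorem MedianRun.exchange_bundle {H M N a b s t : ℕ} {l₁ l₂ : List ℕ} (hN : N = 2 * (M + 1))
    (hab : a < b) (hs : s < N) (ht : t < N) (hs2 : s % 2 = 0) (ht2 : t % 2 = 1)
    (hH : l₁.length + N = H) :
    ∃ r, MedianRun H (l₁ ++ (bundle N s a ++ (bundle N t b ++ l₂)))
      (l₁ ++ (bundle N (t + 1) b ++ (bundle N (s + 1) a ++ l₂))) r (2 * N - 1) ∧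
      ∀ v, (v / N = a → r v + slotEven N s (v % N) ≤ 2 + slotEven N (s + 1) (v % N)) ∧
        (v / N = b → r v + slotEven N t (v % N) ≤ 2 + slotEven N (t + 1) (v % N)) ∧
        (v / N ≠ a → v / N ≠ b → r v = 0) := by
  subst hN
  set N := 2 * (M + 1) with hN
  set xs := (List.range (M + 1)).map fun j =>
    (a * N + label N s (2 * j), a * N + label N s (2 * j + 1)) with hxs
  set ys := (List.range M).map fun j =>
    (b * N + label N t (2 * j + 1), b * N + label N t (2 * j + 2)) with hys
  have hX : bundle N s a = flat xs := map_range_two_mul _ _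
  have hY : bundle N t b = (b * N + label N t 0) :: (flat ys ++ [b * N + label N t (2 * M + 1)]) :=
    map_range_two_mul_succ _ _
  have hX' : bundle N (s + 1) a = flat (xs.map Prod.swap) := by
    refine (map_range_two_mul _ _).trans ?_
    congr 1
    rw [hxs, List.map_map]
    refine List.map_congr_left fun j hj => ?_
    rw [List.mem_range] at hj
    simp only [Function.comp, Prod.swap]
    rw [label_succ_left (by omega), label_succ_right (by omega)]
  have hY' : bundle N (t + 1) b =
      (b * N + label N t 0) :: (flat (ys.map Prod.swap) ++ [b * N + label N t (2 * M + 1)]) := by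
    refine (map_range_two_mul_succ _ _).trans ?_
    rw [label_succ_zero ht ht2, label_succ_last ht ht2]
    congr 3
    rw [hys, List.map_map]
    refine (List.map_congr_left fun j hj => ?_)
    rw [List.mem_range] at hj
    simp only [Function.comp, Prod.swap]
    rw [label_succ_left (by omega), label_succ_right (by omega)]
  have hlt : ∀ x ∈ flat xs, ∀ y ∈ bundle N t b, x < y := fun x hx y hy =>
    lt_of_mem_bundle hs.le hab (hX ▸ hx) hy
  obtain ⟨r, m, hr, hm, hrv⟩ := MedianRun.exchange (H := H) ys xs (b * N + label N t 0)
    (b * N + label N t (2 * M + 1)) l₁ l₂ [] [] (by simp [hxs, hys]) (by simp [hxs]; omega)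
    (by
      intro p hp
      simp only [hxs, List.mem_map, List.mem_range] at hp
      obtain ⟨j, hj, rfl⟩ := hp
      exact Nat.add_lt_add_left (label_lt_label hs (by omega) (by omega)) _)
    (by
      intro p hp
      simp only [hys, List.mem_map, List.mem_range] at hp
      obtain ⟨j, hj, rfl⟩ := hp
      exact Nat.add_lt_add_left (label_lt_label ht (by omega) (by omega)) _)
    (by simp) (fun x hx => hlt x hx _ (by simp [hY])) (fun x hx => hlt x hx _ (by simp [hY]))
    (fun x hx v hv => hlt x hx v (by simp [hY, hv]))
  have hm' : m = 2 * N - 1 := by simp [hm, hys]; omega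
  refine ⟨r, ?_, fun v => ?_⟩
  · rw [hX, hY, hX', hY', ← hm']
    simpa using hr
  · have hmod : v % N < N := Nat.mod_lt _ (by omega)
    have e1 := count_map_label (x := a) (M := M + 1) (g := fun j => 2 * j) v hs.le
      (by intros; omega) (by intro i j h; simpa using h)
    have e2 := count_map_label (x := a) (M := M + 1) (g := fun j => 2 * j + 1) v hs.le
      (by intros; omega) (by intro i j h; simpa using h)
    have e3 := count_map_label (x := b) (M := M) (g := fun j => 2 * j + 1) v ht.le
      (by intros; omega) (by intro i j h; simpa using h)
    have e4 := count_map_label (x := b) (M := M) (g := fun j => 2 * j + 2) v ht.le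
      (by intros; omega) (by intro i j h; simpa using h)
    have e5 := count_label (x := b) (p := 0) v ht.le (by omega)
    have e6 := count_label (x := b) (p := 2 * M + 1) v ht.le (by omega)
    have h1 := hrv v
    rw [← List.singleton_append, List.count_append, hxs, hys] at h1
    simp only [List.map_map, Function.comp_def] at h1
    have f1 := slotEven_succ_of_even hs hmod hs2
    have f2 := slotEven_succ_of_odd (M := M) (k := v % N) ht2
    have f3 : slotEven N s (v % N) = 1 - slot N s (v % N) % 2 := rfl
    have f4 : slotEven N t (v % N) = 1 - slot N t (v % N) % 2 := rfl
    rw [← hN] at f1 f2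
    -- An entry at an even index takes part once, and one at an odd index three times, except once
    -- at the last index in an odd round. After three swaps the index is even, so the excess over
    -- two is paid by the potential.
    refine ⟨fun hv => ?_, fun hv => ?_, fun hva hvb => ?_⟩
    · rw [e3.resolve_right (by omega), e4.resolve_right (by omega), e5.resolve_right (by omega),
        e6.resolve_right (by omega)] at h1
      rcases e1 with e1 | ⟨e1, -, i, hi, hi'⟩ <;> rcases e2 with e2 | ⟨e2, -, j, hj, hj'⟩ <;> omega
    · rw [e1.resolve_right (by omega), e2.resolve_right (by omega)] at h1
      rcases e3 with e3 | ⟨e3, -, i, hi, hi'⟩ <;> rcases e4 with e4 | ⟨e4, -, j, hj, hj'⟩ <;>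
        rcases e5 with e5 | ⟨e5, -, hk⟩ <;> rcases e6 with e6 | ⟨e6, -, hk'⟩ <;> omega
    · rw [e1.resolve_right (by omega), e2.resolve_right (by omega), e3.resolve_right (by omega),
        e4.resolve_right (by omega), e5.resolve_right (by omega), e6.resolve_right (by omega)] at h1
      simpa using h1

/-! ### Replacing entries by bundles -/

/-- The list in which every entry `x` is replaced by its bundle after `φ x` rounds. -/
def lift (N : ℕ) (φ : ℕ → ℕ) (l : List ℕ) : List ℕ := l.flatMap fun x => bundle N (φ x) x

theorem lift_append (N : ℕ) (φ : ℕ → ℕ) (l l' : List ℕ) :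
    lift N φ (l ++ l') = lift N φ l ++ lift N φ l' := by simp [lift]

theorem lift_cons (N : ℕ) (φ : ℕ → ℕ) (x : ℕ) (l : List ℕ) :
    lift N φ (x :: l) = bundle N (φ x) x ++ lift N φ l := by simp [lift]

theorem length_lift (N : ℕ) (φ : ℕ → ℕ) (l : List ℕ) : (lift N φ l).length = l.length * N := by
  induction l with
  | nil => simp [lift]
  | cons x l ih => rw [lift_cons]; simp [ih, add_mul, add_comm]

theorem lift_congr {N : ℕ} {φ ψ : ℕ → ℕ} {l : List ℕ} (h : ∀ x ∈ l, φ x = ψ x) :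
    lift N φ l = lift N ψ l := List.flatMap_congr fun x hx => by rw [h x hx]

theorem nodup_bundle {N s x : ℕ} (hs : s ≤ N) : (bundle N s x).Nodup := by
  refine List.Nodup.map_on ?_ List.nodup_range
  intro i hi j hj hij
  rw [List.mem_range] at hi hj
  have := congrArg (slot N s) (Nat.add_left_cancel hij)
  rwa [slot_label hs hi, slot_label hs hj] at this

theorem nodup_lift {N : ℕ} {φ : ℕ → ℕ} {l : List ℕ} (hl : l.Nodup) (hφ : ∀ x ∈ l, φ x ≤ N) :
    (lift N φ l).Nodup := by
  induction l with
  | nil => simp [lift]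
  | cons x l ih =>
    rw [List.nodup_cons] at hl
    rw [lift_cons, List.nodup_append]
    refine ⟨nodup_bundle (hφ x (by simp)), ih hl.2 fun y hy => hφ y (by simp [hy]), ?_⟩
    intro v hv w hw
    obtain ⟨y, hy, hw⟩ := List.mem_flatMap.1 hw
    have hxy : x ≠ y := fun h => hl.1 (h ▸ hy)
    rcases Nat.lt_or_gt_of_ne hxy with h | h
    · exact (lt_of_mem_bundle (hφ x (by simp)) h hv hw).ne
    · exact (lt_of_mem_bundle (hφ y (by simp [hy])) h hw hv).ne'

/-- A run on `l` gives a run on the list in which bundles replace the entries of `l`.  The bundles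
before the median are at even rounds, and those after the median at odd rounds. -/
theorem MedianRun.lift {H M N : ℕ} (hN : N = 2 * (M + 1)) {l l' : List ℕ} {r : ℕ → ℕ} {m : ℕ}
    (h : MedianRun H l l' r m) (φ : ℕ → ℕ) (hl : l.Nodup)
    (hφ : ∀ k x, l[k]? = some x → φ x % 2 = if k < H then 0 else 1)
    (hr : ∀ x ∈ l, φ x + r x ≤ N) :
    ∃ r', MedianRun (H * N) (TopSearch.lift N φ l) (TopSearch.lift N (φ + r) l') r'
      (m * (2 * N - 1)) ∧ ∀ v, r' v + slotEven N (φ (v / N)) (v % N) ≤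
        2 * r (v / N) + slotEven N (φ (v / N) + r (v / N)) (v % N) := by
  induction h generalizing φ with
  | refl l => exact ⟨0, by simpa using MedianRun.refl _, by simp⟩
  | @side l₁ l₂ l' a b r m hab hH h ih =>
    obtain ⟨r', hr', hb⟩ := ih φ (by
        refine (List.Perm.nodup_iff ?_).1 hl
        exact List.Perm.append_left _ (List.Perm.swap _ _ _))
      (by
        intro k x hk
        -- The swapped positions are on the same side of the median, so both round numbers have the
        -- parity required at either position.
        have ha := hφ l₁.length a (by simp)
        have hb := hφ (l₁.length + 1) b (by simp)
        rcases getElem?_swap hk with ⟨rfl, rfl⟩ | ⟨rfl, rfl⟩ | ⟨-, -, hk⟩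
        · rw [hb]; split_ifs <;> omega
        · rw [ha]; split_ifs <;> omega
        · exact hφ k x hk)
      (by
        intro x hx
        refine hr x ?_
        simp only [List.mem_append, List.mem_cons] at hx ⊢
        tauto)
    refine ⟨r', ?_, hb⟩
    simp only [lift_append, lift_cons] at hr' ⊢
    refine (swap_blocks _ _ _ _ ?_ ?_).free_trans hr'
    · intro x hx y hy
      exact lt_of_mem_bundle ((Nat.le_add_right _ _).trans (hr a (by simp))) hab hx hy
    · simp only [length_lift, length_bundle]
      rcases Nat.lt_or_ge l₁.length H with h | h
      · right
        have := Nat.mul_le_mul_right N (show l₁.length + 2 ≤ H by omega)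
        linarith
      · exact Or.inl (Nat.mul_le_mul_right N h)
  | @mid l₁ l₂ l' a b r m hab hH h ih =>
    -- A median swap advances both bundles by one round. This flips the parity of their round
    -- numbers just as they change sides.
    set e : ℕ → ℕ := Pi.single a 1 + Pi.single b 1 with he
    have hea : e a = 1 := by simp [he, hab.ne]
    have heb : e b = 1 := by simp [he, hab.ne']
    have hex : ∀ x, x ≠ a → x ≠ b → e x = 0 := fun x h1 h2 => by simp [he, h1, h2]
    have ha := hφ l₁.length a (by simp)
    have hb := hφ (l₁.length + 1) b (by simp)
    rw [if_pos (by omega)] at ha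
    rw [if_neg (by omega)] at hb
    have hra := hr a (by simp)
    have hrb := hr b (by simp)
    simp only [Pi.add_apply, hea, heb] at hra hrb
    have hl' : (l₁ ++ b :: a :: l₂).Nodup := by
      refine (List.Perm.nodup_iff ?_).1 hl
      exact List.Perm.append_left _ (List.Perm.swap _ _ _)
    have hne : ∀ x, x ∈ l₁ ∨ x ∈ l₂ → x ≠ a ∧ x ≠ b := by
      rw [List.nodup_append] at hl
      simp only [List.nodup_cons, List.mem_cons, not_or] at hl
      obtain ⟨-, ⟨h2, h3, -⟩, h4⟩ := hl
      rintro x (hx | hx)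
      · exact ⟨h4 x hx a (by simp), h4 x hx b (by simp)⟩
      · exact ⟨fun h => h2.2 (h ▸ hx), fun h => h3 (h ▸ hx)⟩
    obtain ⟨r', hr', hb'⟩ := ih (φ + e) hl'
      (by
        intro k x hk
        have hk0 := hk
        rcases getElem?_swap hk with ⟨rfl, rfl⟩ | ⟨rfl, rfl⟩ | ⟨h1, h2, hk⟩
        · rw [Pi.add_apply, heb, if_pos (by omega)]; omega
        · rw [Pi.add_apply, hea, if_neg (by omega)]; omega
        · have hxl : x ≠ a ∧ x ≠ b := by
            have hklt := (List.getElem?_eq_some_iff.1 hk0).1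
            constructor
            · rintro rfl
              exact h2 ((List.getElem?_inj hklt hl').1 (hk0.trans (by simp)))
            · rintro rfl
              exact h1 ((List.getElem?_inj hklt hl').1 (hk0.trans (by simp)))
          rw [Pi.add_apply, hex x hxl.1 hxl.2]
          exact hφ k x hk)
      (by
        intro x hx
        rw [Pi.add_apply, add_assoc]
        refine hr x ?_
        simp only [List.mem_append, List.mem_cons] at hx ⊢
        tauto)
    obtain ⟨r₁, hr₁, hb₁⟩ := MedianRun.exchange_bundle (H := H * N) (M := M) (N := N)
      (l₁ := TopSearch.lift N φ l₁) (l₂ := TopSearch.lift N φ l₂) hN hab (s := φ a) (t := φ b)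
      (by omega) (by omega) ha hb (by rw [length_lift, ← hH]; ring)
    have e1 : ∀ l, (∀ x ∈ l, x ∈ l₁ ∨ x ∈ l₂) →
        TopSearch.lift N (φ + e) l = TopSearch.lift N φ l := fun l h =>
      lift_congr fun x hx => by
        rw [Pi.add_apply, hex x (hne x (h x hx)).1 (hne x (h x hx)).2, add_zero]
    refine ⟨r₁ + r', ?_, fun v => ?_⟩
    · rw [← add_assoc, add_mul, one_mul]
      simp only [lift_append, lift_cons] at hr' ⊢
      rw [e1 l₁ fun x => Or.inl, e1 l₂ fun x => Or.inr, Pi.add_apply, Pi.add_apply, hea, heb] at hr'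
      exact hr₁.trans hr'
    · have h1 := hb' v
      obtain ⟨h2, h3, h4⟩ := hb₁ v
      simp only [Pi.add_apply] at h1 ⊢
      rw [← add_assoc (φ (v / N))]
      by_cases hva : v / N = a
      · have := h2 hva
        rw [hva] at h1 ⊢
        rw [hea] at h1 ⊢
        omega
      · by_cases hvb : v / N = b
        · have := h3 hvb
          rw [hvb] at h1 ⊢
          rw [heb] at h1 ⊢
          omega
        · have := h4 hva hvb
          rw [hex _ hva hvb] at h1 ⊢
          simp only [add_zero] at h1 ⊢
          omega

/-! ### The algorithm on an arc that only exchanges its ends -/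

section Swap

variable {V : Type}

theorem forwardScan_eq (A : V → V → Bool) (vertex : ℕ → Option V) (w : V) (i j : ℕ) (hij : i ≤ j)
    (h : ∀ p, i ≤ p → p < j → (vertex p).any (A w) = false) :
    (forwardScan A vertex [w] i j).1 = j ∧ j - i ≤ (forwardScan A vertex [w] i j).2 := by
  induction hd : j - i generalizing i with
  | zero =>
    rw [forwardScan, if_neg (by omega)]
    exact ⟨by simp; omega, by omega⟩
  | succ d ih =>
    have h1 := ih (i + 1) (by omega) (fun p hp => h p (by omega)) (by omega)
    rw [forwardScan, if_pos (by omega)]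
    simp only [scan, h i le_rfl (by omega), Bool.false_eq_true, if_false]
    exact ⟨h1.1, by omega⟩

variable [DecidableEq V]

theorem reorderForward_eq (n : ℕ) (A : V → V → Bool) (w : V) (o : Order V) (j : ℕ) (hj : j ≤ n)
    (h : o.vertex j = none) : (reorderForward n A [w] o j).1 =
      ⟨Function.update o.vertex j (some w), Function.update o.position w j⟩ := by
  rw [reorderForward, if_pos ⟨by simp, hj⟩]
  simp only [h, Option.isSome_none, Bool.false_eq_true, if_false, scan, refill]
  rw [reorderForward, if_neg (by simp)]

/-- Going down from `j - 1`, the loop passes occupied positions whose vertices have no arc to `v`;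
the first null entry is at `i`. -/
theorem reorderBackward_eq (A : V → V → Bool) (v : V) (o : Order V) (i j : ℕ) (hi : 1 ≤ i)
    (hij : i < j) (hvi : o.vertex i = none)
    (h : ∀ p, i < p → p < j → ∃ d, o.vertex p = some d ∧ A d v = false) :
    (reorderBackward A [v] o j).1 =
      ⟨Function.update o.vertex i (some v), Function.update o.position v i⟩ := by
  induction j with
  | zero => omega
  | succ j ih =>
    rw [reorderBackward, if_pos ⟨by simp, by omega⟩]
    rcases Nat.lt_or_ge i j with hlt | hge
    · obtain ⟨d, hd, hA⟩ := h j hlt (by omega)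
      simp only [Nat.add_sub_cancel, hd, Option.isSome_some, if_true, scan, Option.any_some, hA,
        Bool.false_eq_true, if_false, refill]
      exact ih hlt fun p hp hp' => h p hp (by omega)
    · obtain rfl : i = j := by omega
      simp only [Nat.add_sub_cancel, hvi, Option.isSome_none, Bool.false_eq_true, if_false, scan,
        refill]
      rw [reorderBackward, if_neg (by simp)]

/-- If there are no arcs between `v`, `w` and the vertices in between, then the new arc `(v, w)`
exchanges `v` and `w` in the order. -/
theorem addArc_eq_swap (n : ℕ) (A : V → V → Bool) (o : Order V) (v w : V) (i j : ℕ)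
    (hi : o.position w = i) (hj : o.position v = j) (h1 : 1 ≤ i) (hij : i < j) (hn : j ≤ n)
    (hvw : v ≠ w) (hA : A w v = false)
    (h : ∀ p, i < p → p < j → ∃ d, o.vertex p = some d ∧ d ≠ v ∧ d ≠ w ∧
      A w d = false ∧ A d v = false) :
    j - i - 1 ≤ (addArc n A o v w).2 ∧ (addArc n A o v w).1 =
      some (fun x y => A x y || (decide (x = v) && decide (y = w)),
        ⟨fun p => if p = i then some v else if p = j then some w else o.vertex p,
          fun x => if x = v then i else if x = w then j else o.position x⟩) := by
  set A' : V → V → Bool := fun x y => A x y || (decide (x = v) && decide (y = w)) with hA'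
  set vx := Function.update (Function.update o.vertex i none) j none with hvx
  have hvxp : ∀ p, i < p → p < j → vx p = o.vertex p := fun p hp hp' => by
    simp [hvx, show p ≠ i by omega, show p ≠ j by omega]
  have hscan := forwardScan_eq A' vx w (i + 1) j (by omega) (fun p hp hp' => by
    obtain ⟨d, hd, hdv, hdw, hwd, -⟩ := h p (by omega) hp'
    simp [hvxp p (by omega) hp', hd, hA', hwd, hdw])
  have hs : search A' o v w =
      (⟨[w], [v], vx, j, j⟩, 8 + (1 + (forwardScan A' vx [w] (i + 1) j).2 + 1)) := by
    simp only [search, hi, hj]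
    rw [searchLoop]
    simp only [← hvx, hscan.1, lt_irrefl, if_false]
  have hc : cycleTest A' [v] [w] = (false, 1) := by
    have : A' w v = false := by simp [hA', hA, Ne.symm hvw]
    simp [cycleTest, scan, this]
  simp only [addArc, hi, hj, hij, if_true]
  rw [← hA', hs]
  simp only [hc, Bool.false_eq_true, if_false]
  refine ⟨by omega, ?_⟩
  rw [reorderForward_eq n A' w ⟨vx, o.position⟩ j hn (by simp [hvx]),
    reorderBackward_eq A' v _ i j h1 hij]
  · congr 3
    · funext p
      by_cases hp : p = i
      · simp [hp]
      · by_cases hp' : p = j <;> simp [hp, hp', hvx, Function.update_apply]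
    · funext x
      simp [Function.update_apply]
  · simp [hvx, hij.ne]
  · intro p hp hp'
    obtain ⟨d, hd, hdv, -, -, hdv'⟩ := h p hp hp'
    refine ⟨d, ?_, ?_⟩
    · simp [hp'.ne, hvxp p hp hp', hd]
    · simp [hA', hdv', hdv]

end Swap

/-! ### Carrying out a run by arc additions -/

section Simulation

variable {V : Type}

/-- The position of item number `k` (from `0`), if there are `K` other vertices between the first
`H` items and the remaining items. -/
def place (H K k : ℕ) : ℕ := if k < H then k + 1 else k + 1 + K

/-- The order `o` consists of the items `e x`, for `x` in `l`, in the order of `l`, with `K` other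
vertices in the middle, and all arcs of `A` lead from an item to one with a smaller label and agree
with the order. -/
structure Represents (H K : ℕ) (e : ℕ → V) (A : V → V → Bool) (o : Order V) (l : List ℕ) :
    Prop where
  nodup : l.Nodup
  length : l.length = 2 * H
  inj : ∀ x ∈ l, ∀ y ∈ l, e x = e y → x = y
  item : ∀ k x, l[k]? = some x →
    o.position (e x) = place H K k ∧ o.vertex (place H K k) = some (e x)
  other : ∀ p, H < p → p ≤ H + K → ∃ d, o.vertex p = some d ∧ ∀ x ∈ l, e x ≠ d
  arc : ∀ u v, A u v = true → ∃ x ∈ l, ∃ y ∈ l, x < y ∧ u = e y ∧ v = e x ∧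
    o.position u < o.position v

variable [DecidableEq V]

/-- A swap of adjacent items is brought about by a new arc.  It takes time at least `K` if it is
the swap in the middle. -/
theorem Represents.swap {H K : ℕ} {e : ℕ → V} {A : V → V → Bool} {o : Order V}
    {l₁ l₂ : List ℕ} {a b : ℕ} (hab : a < b) (h : Represents H K e A o (l₁ ++ a :: b :: l₂)) :
    A (e b) (e a) = false ∧ (l₁.length + 1 = H → K ≤ (addArc (2 * H + K) A o (e b) (e a)).2) ∧
      ∃ o', (addArc (2 * H + K) A o (e b) (e a)).1 =
        some (fun x y => A x y || (decide (x = e b) && decide (y = e a)), o') ∧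
        Represents H K e (fun x y => A x y || (decide (x = e b) && decide (y = e a))) o'
          (l₁ ++ b :: a :: l₂) := by
  obtain ⟨hnd, hlen, hinj, hitem, hother, harc⟩ := h
  have hperm : (l₁ ++ b :: a :: l₂).Perm (l₁ ++ a :: b :: l₂) :=
    List.Perm.append_left _ (List.Perm.swap _ _ _)
  have hnd' : (l₁ ++ b :: a :: l₂).Nodup := hperm.nodup_iff.2 hnd
  obtain ⟨hia, hva⟩ := hitem l₁.length a (by simp)
  obtain ⟨hib, hvb⟩ := hitem (l₁.length + 1) b (by simp)
  have hal : a ∈ l₁ ++ a :: b :: l₂ := by simp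
  have hbl : b ∈ l₁ ++ a :: b :: l₂ := by simp
  have heab : e b ≠ e a := fun h => hab.ne' (hinj b hbl a hal h)
  have hlen' : l₁.length + 2 ≤ 2 * H := by rw [← hlen]; simp
  set i := place H K l₁.length with hi
  set j := place H K (l₁.length + 1) with hj
  have hij : i < j := by rw [hi, hj]; unfold place; split_ifs <;> omega
  have hbetween : ∀ p, i < p → p < j → ∃ d, o.vertex p = some d ∧
      ∀ x ∈ l₁ ++ a :: b :: l₂, e x ≠ d := fun p hp hp' => by
    refine hother p ?_ ?_ <;> rw [hi] at hp <;> rw [hj] at hp' <;> unfold place at hp hp' <;>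
      split_ifs at hp hp' <;> omega
  have hrest : ∀ k, k ≠ l₁.length → k ≠ l₁.length + 1 → place H K k < i ∨ j < place H K k := by
    intro k hk hk'
    rw [hi, hj]; unfold place; split_ifs <;> omega
  have hba : A (e b) (e a) = false := by
    by_contra hc
    obtain ⟨_, _, _, _, _, _, _, h⟩ := harc _ _ (by simpa using hc)
    omega
  have hab' : A (e a) (e b) = false := by
    by_contra hc
    obtain ⟨x, hx, y, hy, hxy, h1, h2, -⟩ := harc _ _ (by simpa using hc)
    have := hinj _ hal _ hy h1
    have := hinj _ hbl _ hx h2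
    omega
  obtain ⟨ht, ho⟩ := addArc_eq_swap (2 * H + K) A o (e b) (e a) i j hia hib
    (by rw [hi]; unfold place; split_ifs <;> omega) hij
    (by rw [hj]; unfold place; split_ifs <;> omega) heab hab' (by
      intro p hp hp'
      obtain ⟨d, hd, hdl⟩ := hbetween p hp hp'
      refine ⟨d, hd, (hdl b hbl).symm, (hdl a hal).symm, ?_, ?_⟩
      · by_contra hc
        obtain ⟨x, hx, y, hy, -, -, h2, -⟩ := harc _ _ (by simpa using hc)
        exact hdl x hx h2.symm
      · by_contra hc
        obtain ⟨x, hx, y, hy, -, h1, -, -⟩ := harc _ _ (by simpa using hc)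
        exact hdl y hy h1.symm)
  refine ⟨hba, ?_, _, ho, hnd', hperm.length_eq.trans hlen, ?_, ?_, ?_, ?_⟩
  · intro hH
    have : j - i - 1 = K := by rw [hi, hj]; unfold place; split_ifs <;> omega
    omega
  · exact fun x hx y hy => hinj x (hperm.mem_iff.1 hx) y (hperm.mem_iff.1 hy)
  · intro k x hk
    rcases getElem?_swap hk with ⟨rfl, rfl⟩ | ⟨rfl, rfl⟩ | ⟨h1, h2, hk'⟩
    · simp [← hi]
    · simp [← hj, hij.ne', heab.symm]
    · have hx := hitem k x hk'
      have hxa : e x ≠ e a := fun h => by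
        rw [h, hia] at hx; have := hrest k h1 h2; omega
      have hxb : e x ≠ e b := fun h => by
        rw [h, hib] at hx; have := hrest k h1 h2; omega
      have := hrest k h1 h2
      simp [hxa, hxb, hx.1, hx.2, show place H K k ≠ i by omega, show place H K k ≠ j by omega]
  · intro p hp hp'
    obtain ⟨d, hd, hdl⟩ := hother p hp hp'
    have h1 : p ≠ i := by rw [hi]; unfold place; split_ifs <;> omega
    have h2 : p ≠ j := by rw [hj]; unfold place; split_ifs <;> omega
    exact ⟨d, by simp [h1, h2, hd], fun x hx => hdl x (hperm.mem_iff.1 hx)⟩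
  · have hpos : ∀ x ∈ l₁ ++ a :: b :: l₂, e x ≠ e a → e x ≠ e b →
        o.position (e x) < i ∨ j < o.position (e x) := by
      intro x hx hxa hxb
      obtain ⟨k, hk⟩ := List.mem_iff_getElem?.1 hx
      rw [(hitem k x hk).1]
      refine hrest k ?_ ?_
      · rintro rfl
        simp only [le_refl, List.getElem?_append_right, Nat.sub_self,
          List.getElem?_cons_zero, Option.some.injEq] at hk
        exact hxa (hk ▸ rfl)
      · rintro rfl
        simp at hk
        exact hxb (hk ▸ rfl)
    intro u v huv
    simp only [Bool.or_eq_true, Bool.and_eq_true, decide_eq_true_eq] at huv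
    rcases huv with huv | ⟨rfl, rfl⟩
    · obtain ⟨x, hx, y, hy, hxy, rfl, rfl, hlt⟩ := harc u v huv
      refine ⟨x, hperm.mem_iff.2 hx, y, hperm.mem_iff.2 hy, hxy, rfl, rfl, ?_⟩
      -- An old arc cannot join the two exchanged items, so at most one of its ends moves. The move
      -- stays within `i, …, j`, where there is no other item, so the arc still agrees with the
      -- order.
      have hpx := hpos x hx
      have hpy := hpos y hy
      have hne : ¬ (e y = e a ∧ e x = e b) := fun h => by
        rw [h.1, h.2, hab'] at huv; simp at huv
      by_cases hxa : e x = e a <;> by_cases hxb : e x = e b <;> by_cases hya : e y = e a <;>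
        by_cases hyb : e y = e b <;> simp only [hxa, hxb, hya, hyb, hia, hib, heab, heab.symm,
          if_true, if_false, ne_eq, not_true_eq_false, not_false_eq_true, forall_const, and_self,
          IsEmpty.forall_iff] at * <;> omega
    · exact ⟨a, by simp, b, by simp, hab, rfl, rfl, by simp [heab.symm, hij]⟩

/-- A run is carried out by topological search, with time at least `K` for every swap in the
middle. -/
theorem MedianRun.exists_arcs {H K : ℕ} {e : ℕ → V} {l l' : List ℕ} {r : ℕ → ℕ} {m : ℕ}
    (h : MedianRun H l l' r m) {A : V → V → Bool} {o : Order V} (hA : Represents H K e A o l) :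
    ∃ arcs : List (V × V), m * K ≤ timeFrom (2 * H + K) A o arcs ∧ arcs.Nodup ∧
      ∀ p ∈ arcs, A p.1 p.2 = false ∧ ∃ a ∈ l, ∃ b ∈ l, a < b ∧ p = (e b, e a) := by
  have key : ∀ {l₁ l₂ : List ℕ} {a b t m' : ℕ} {A : V → V → Bool} {o : Order V}, a < b →
      Represents H K e A o (l₁ ++ a :: b :: l₂) →
      t ≤ (addArc (2 * H + K) A o (e b) (e a)).2 →
      (∀ {A : V → V → Bool} {o : Order V}, Represents H K e A o (l₁ ++ b :: a :: l₂) →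
        ∃ arcs : List (V × V), m' * K ≤ timeFrom (2 * H + K) A o arcs ∧ arcs.Nodup ∧
        ∀ p ∈ arcs, A p.1 p.2 = false ∧
          ∃ c ∈ l₁ ++ b :: a :: l₂, ∃ d ∈ l₁ ++ b :: a :: l₂, c < d ∧ p = (e d, e c)) →
      ∃ arcs : List (V × V), t + m' * K ≤ timeFrom (2 * H + K) A o arcs ∧ arcs.Nodup ∧
        ∀ p ∈ arcs, A p.1 p.2 = false ∧
          ∃ c ∈ l₁ ++ a :: b :: l₂, ∃ d ∈ l₁ ++ a :: b :: l₂, c < d ∧ p = (e d, e c) := by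
    intro l₁ l₂ a b t m' A o hab hA ht ih
    have hperm : (l₁ ++ b :: a :: l₂).Perm (l₁ ++ a :: b :: l₂) :=
      List.Perm.append_left _ (List.Perm.swap _ _ _)
    obtain ⟨hf, -, o', ho', hA'⟩ := hA.swap hab
    obtain ⟨arcs, h1, h2, h3⟩ := ih hA'
    refine ⟨(e b, e a) :: arcs, ?_, ?_, ?_⟩
    · simp only [timeFrom, ho']
      omega
    -- Later arcs are absent from the matrix at this point, which already contains the new arc.
    · refine List.nodup_cons.2 ⟨fun hmem => ?_, h2⟩
      simpa using (h3 _ hmem).1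
    · intro p hp
      rcases List.mem_cons.1 hp with rfl | hp
      · exact ⟨hf, a, by simp, b, by simp, hab, rfl⟩
      · obtain ⟨h4, c, hc, d, hd, hcd, rfl⟩ := h3 p hp
        rw [Bool.or_eq_false_iff] at h4
        exact ⟨h4.1, c, hperm.mem_iff.1 hc, d, hperm.mem_iff.1 hd, hcd, rfl⟩
  induction h generalizing A o with
  | refl l => exact ⟨[], by simp, List.nodup_nil, by simp⟩
  | side hab hl _ ih => simpa using key (t := 0) hab hA (Nat.zero_le _) ih
  | mid hab hl _ ih => simpa [add_mul] using key (t := K) hab hA ((hA.swap hab).2.1 hl) ih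

end Simulation

/-! ### The recursion and its transfer to running time -/

/-- There is a run on `2 * H` entries with `m` swaps at the median, in which every entry takes part
in fewer than `D` of them. -/
def HasMedianRun (H D m : ℕ) : Prop :=
  ∃ l l' r, l.Nodup ∧ l.length = 2 * H ∧ MedianRun H l l' r m ∧ ∀ x, r x < D

theorem hasMedianRun_one : HasMedianRun 1 2 1 := by
  refine ⟨[0, 1], [1, 0], _, by simp, rfl,
    MedianRun.mid (l₁ := []) (l₂ := []) zero_lt_one rfl (MedianRun.refl _), fun x => ?_⟩
  simp only [Pi.add_apply, Pi.single_apply, Pi.zero_apply]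
  split_ifs <;> omega

/-- Bundles start at round 0 left of the median and at round 1 right of it. As each entry meets the
median at most `D - 1` times, no bundle exceeds `N` rounds. The potential adds at most one to `2 *
(D - 1)`, which stays below `2 * D`. -/
theorem HasMedianRun.mul {H D m M N : ℕ} (h : HasMedianRun H D m) (hN : N = 2 * (M + 1))
    (hD : D ≤ N) : HasMedianRun (H * N) (2 * D) (m * (2 * N - 1)) := by
  obtain ⟨l, l', r, hnd, hlen, hrun, hr⟩ := h
  set φ : ℕ → ℕ := fun x => if l.idxOf x < H then 0 else 1 with hφ
  have hφ1 : ∀ x, φ x ≤ 1 := fun x => by simp only [hφ]; split_ifs <;> omega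
  obtain ⟨r', hr', hb⟩ := hrun.lift hN φ hnd
    (by
      intro k x hk
      obtain ⟨hkl, rfl⟩ := List.getElem?_eq_some_iff.1 hk
      simp only [hφ, hnd.idxOf_getElem k hkl]
      split_ifs <;> rfl)
    (fun x _ => by have := hr x; have := hφ1 x; omega)
  refine ⟨_, _, r', nodup_lift hnd fun x _ => by have := hφ1 x; omega, ?_, hr', fun v => ?_⟩
  · rw [length_lift, hlen, mul_assoc]
  · have := hb v
    have := hr (v / N)
    have := slotEven_le N (φ (v / N) + r (v / N)) (v % N)
    omega

theorem HasMedianRun.exists_time {H D m K n : ℕ} (h : HasMedianRun H D m) (hH : 0 < H)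
    (hn : n = 2 * H + K) (σ : Equiv.Perm (Fin n)) :
    ∃ arcs, IsAcyclicSequence arcs ∧ m * K ≤ time σ arcs := by
  subst hn
  obtain ⟨l, l', r, hnd, hlen, hrun, -⟩ := h
  have hplace : ∀ k, k < 2 * H → 1 ≤ place H K k ∧ place H K k ≤ 2 * H + K := fun k hk => by
    unfold place; split_ifs <;> omega
  -- An entry of `l` names the vertex that initially occupies its place; the default is reached only
  -- for numbers outside `l`.
  set e : ℕ → Fin (2 * H + K) := fun x => if h : place H K (l.idxOf x) - 1 < 2 * H + K then
    σ.symm ⟨_, h⟩ else ⟨0, by omega⟩ with he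
  have hpos : ∀ k x, l[k]? = some x → (σ (e x) : ℕ) + 1 = place H K k ∧ k < 2 * H := by
    intro k x hk
    obtain ⟨hkl, rfl⟩ := List.getElem?_eq_some_iff.1 hk
    have h1 := hplace k (by omega)
    have h2 : place H K k - 1 < 2 * H + K := by omega
    simp only [he, hnd.idxOf_getElem k hkl, h2, dite_true, Equiv.apply_symm_apply]
    omega
  have hinj : ∀ x ∈ l, ∀ y ∈ l, e x = e y → x = y := by
    intro x hx y hy hxy
    obtain ⟨k, hk⟩ := List.mem_iff_getElem?.1 hx
    obtain ⟨k', hk'⟩ := List.mem_iff_getElem?.1 hy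
    have h1 := hpos k x hk
    have h2 := hpos k' y hk'
    rw [hxy] at h1
    have h3 := h1.1.symm.trans h2.1
    have h4 : k = k' := by unfold place at h3; split_ifs at h3 <;> omega
    rw [h4, hk'] at hk
    exact (Option.some.inj hk).symm
  have hrep : Represents H K e (fun _ _ => false) (initialOrder σ) l := by
    refine ⟨hnd, hlen, hinj, ?_, ?_, by simp⟩
    · intro k x hk
      obtain ⟨h1, h2⟩ := hpos k x hk
      have h3 := hplace k h2
      refine ⟨h1, ?_⟩
      simp only [initialOrder, h3, and_self, dite_true, Option.some.injEq]
      rw [Equiv.symm_apply_eq]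
      exact Fin.ext (by simp; omega)
    · intro p hp hp'
      have h3 : 1 ≤ p ∧ p ≤ 2 * H + K := by omega
      refine ⟨σ.symm ⟨p - 1, by omega⟩, by simp only [initialOrder, h3, and_self, dite_true], ?_⟩
      intro x hx hxe
      obtain ⟨k, hk⟩ := List.mem_iff_getElem?.1 hx
      obtain ⟨h1, h2⟩ := hpos k x hk
      rw [hxe, Equiv.apply_symm_apply] at h1
      simp only [place] at h1
      split_ifs at h1 <;> omega
  obtain ⟨arcs, h1, h2, h3⟩ := hrun.exists_arcs hrep
  refine ⟨arcs, ⟨h2, fun v hv => ?_⟩, h1⟩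
  -- Labels strictly decrease along every path, so no path closes up.
  have key : ∀ u v, Relation.TransGen (fun x y => (x, y) ∈ arcs) u v →
      ∃ a ∈ l, ∃ b ∈ l, a < b ∧ u = e b ∧ v = e a := by
    intro u v huv
    have single : ∀ u v, (u, v) ∈ arcs → ∃ a ∈ l, ∃ b ∈ l, a < b ∧ u = e b ∧ v = e a :=
      fun u v h => by
        obtain ⟨-, a, ha, b, hb, hab, hp⟩ := h3 _ h
        exact ⟨a, ha, b, hb, hab, congrArg Prod.fst hp, congrArg Prod.snd hp⟩
    induction huv with
    | single h => exact single _ _ h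
    | tail _ h ih =>
      obtain ⟨a, ha, b, hb, hab, rfl, rfl⟩ := ih
      obtain ⟨c, hc, d, hd, hcd, had, rfl⟩ := single _ _ h
      have := hinj a ha d hd had
      exact ⟨c, hc, b, hb, by omega, rfl, rfl⟩
  obtain ⟨a, ha, b, hb, hab, rfl, hv⟩ := key v v hv
  exact hab.ne' (hinj b hb a ha hv)

/-! ### Choice of parameters and estimates -/

/-- The number `1 + 2 + ⋯ + i`. -/
def triangle (i : ℕ) : ℕ := ∑ j ∈ Finset.range (i + 1), j

theorem triangle_succ (i : ℕ) : triangle (i + 1) = triangle i + (i + 1) :=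
  Finset.sum_range_succ _ _

theorem two_mul_triangle (i : ℕ) : 2 * triangle i = i * (i + 1) := by
  induction i with
  | zero => rfl
  | succ i ih => rw [triangle_succ, mul_add, ih]; ring

/-- Each level uses the smallest admissible bundle size, `N = D = 2 ^ (i + 1)`. The factor `2 * N -
1` falls short of `2 * N`; the `+ 1` in `2 ^ i + 1` absorbs this loss, and without it the induction
would not close. -/
theorem exists_hasMedianRun (i : ℕ) : ∃ m, HasMedianRun (2 ^ triangle i) (2 ^ (i + 1)) m ∧
    2 ^ triangle i * (2 ^ i + 1) ≤ 2 * m := by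
  induction i with
  | zero => exact ⟨1, hasMedianRun_one, by simp [triangle]⟩
  | succ i ih =>
    obtain ⟨m, hm, hle⟩ := ih
    have hq : 1 ≤ 2 ^ i := Nat.one_le_two_pow
    obtain ⟨q, hq⟩ := Nat.exists_eq_add_of_le hq
    refine ⟨m * (2 * 2 ^ (i + 1) - 1), ?_, ?_⟩
    · rw [triangle_succ, pow_add, pow_succ 2 (i + 1), mul_comm (2 ^ (i + 1)) 2]
      exact hm.mul (M := q) (by rw [pow_succ, hq]; ring) le_rfl
    · rw [triangle_succ, pow_add, pow_succ 2 i, hq]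
      rw [hq] at hle
      rw [show 2 * ((1 + q) * 2) - 1 = 4 * q + 3 by omega]
      calc 2 ^ triangle i * ((1 + q) * 2) * ((1 + q) * 2 + 1)
          ≤ 2 ^ triangle i * (1 + q + 1) * (4 * q + 3) := by
            rw [mul_assoc (2 ^ triangle i), mul_assoc (2 ^ triangle i)]
            refine Nat.mul_le_mul_left _ ?_
            nlinarith
        _ ≤ 2 * m * (4 * q + 3) := Nat.mul_le_mul_right _ hle
        _ = 2 * (m * (4 * q + 3)) := by ring

theorem two_pow_sqrt_le {n i : ℕ} (hn : 0 < n) (h : n ≤ 2 ^ (2 + triangle (i + 2))) :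
    (2 : ℝ) ^ √(2 * Real.logb 2 n) ≤ 16 * 2 ^ i := by
  have h1 : Real.logb 2 n ≤ 2 + triangle (i + 2) := by
    rw [Real.logb_le_iff_le_rpow one_lt_two (by exact_mod_cast hn)]
    have : (n : ℝ) ≤ (2 : ℝ) ^ (2 + triangle (i + 2)) := by exact_mod_cast h
    rw [← Real.rpow_natCast] at this
    simpa using this
  have h2 : (2 : ℝ) * triangle (i + 2) = (i + 2) * (i + 2 + 1) := by
    exact_mod_cast two_mul_triangle (i + 2)
  -- The bound used is `4 + (i + 2) * (i + 3) ≤ (i + 4) ^ 2`.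
  have h3 : √(2 * Real.logb 2 n) ≤ (i + 4 : ℕ) := by
    refine Real.sqrt_le_iff.2 ⟨by positivity, ?_⟩
    push_cast
    nlinarith
  calc (2 : ℝ) ^ √(2 * Real.logb 2 n) ≤ (2 : ℝ) ^ ((i + 4 : ℕ) : ℝ) :=
        Real.rpow_le_rpow_of_exponent_le one_le_two h3
    _ = 16 * 2 ^ i := by rw [Real.rpow_natCast, pow_add]; norm_num; ring

theorem two_le_addArc {V : Type} [DecidableEq V] (n : ℕ) (A : V → V → Bool) (o : Order V)
    (v w : V) : 2 ≤ (addArc n A o v w).2 := by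
  unfold addArc
  dsimp only
  split_ifs <;> dsimp only <;> omega

theorem exists_two_le_time {n : ℕ} (hn : 2 ≤ n) (σ : Equiv.Perm (Fin n)) :
    ∃ arcs, IsAcyclicSequence arcs ∧ 2 ≤ time σ arcs := by
  refine ⟨[(⟨0, by omega⟩, ⟨1, by omega⟩)], ⟨by simp, fun v hv => ?_⟩, ?_⟩
  · have key : ∀ u v : Fin n, Relation.TransGen
        (fun x y => (x, y) ∈ [((⟨0, by omega⟩, ⟨1, by omega⟩) : Fin n × Fin n)]) u v → u < v := by
      intro u v huv
      induction huv with
      | single h => simp at h; simp [h]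
      | tail _ h ih => simp at h; exact ih.trans (by simp [h])
    exact lt_irrefl _ (key v v hv)
  · have := two_le_addArc n (fun _ _ => false) (initialOrder σ) ⟨0, by omega⟩ ⟨1, by omega⟩
    simp only [time, timeFrom]
    split <;> omega

theorem exists_le_time {n : ℕ} (hn : 8 ≤ n) (σ : Equiv.Perm (Fin n)) :
    ∃ arcs i, IsAcyclicSequence arcs ∧ n ≤ 2 ^ (2 + triangle (i + 2)) ∧
      n ^ 2 * 2 ^ i ≤ 32 * time σ arcs := by
  obtain ⟨i, hi, hi'⟩ : ∃ i, 2 ^ (2 + triangle (i + 1)) ≤ n ∧ n < 2 ^ (2 + triangle (i + 2)) := by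
    have hex : ∃ k, n < 2 ^ (2 + triangle (k + 1)) := ⟨n, by
      refine Nat.lt_two_pow_self.trans_le (Nat.pow_le_pow_right (by omega) ?_)
      rw [triangle_succ]; omega⟩
    classical
    -- This is where `8 ≤ n` enters: `2 ^ (2 + triangle 1) = 8`.
    have h0 : Nat.find hex ≠ 0 := fun h => by
      have := Nat.find_spec hex
      rw [h] at this
      simp [triangle, Finset.sum_range_succ] at this
      omega
    refine ⟨Nat.find hex - 1, ?_, ?_⟩
    · exact not_lt.1 (Nat.find_min hex (by omega))
    · have := Nat.find_spec hex
      rwa [show Nat.find hex - 1 + 2 = Nat.find hex + 1 by omega]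
  obtain ⟨m, hm, hle⟩ := exists_hasMedianRun i
  have hH : 0 < 2 ^ triangle i := by positivity
  set H := 2 ^ triangle i with hHdef
  have hn' : 2 ^ i * (8 * H) ≤ n := by
    refine le_trans (le_of_eq ?_) hi
    rw [triangle_succ, pow_add, pow_add, pow_succ, ← hHdef]
    ring
  have ht : 2 ^ i ≤ n / (8 * H) := (Nat.le_div_iff_mul_le (by omega)).2 hn'
  obtain ⟨t, htt⟩ : ∃ t, n / (8 * H) = t + 1 :=
    Nat.exists_eq_succ_of_ne_zero (by have : 1 ≤ 2 ^ i := Nat.one_le_two_pow; omega)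
  have h1 : (t + 1) * (8 * H) ≤ n := htt ▸ Nat.div_mul_le_self n (8 * H)
  have h2 : n < (t + 2) * (8 * H) := (Nat.div_lt_iff_lt_mul (by omega)).1 (by omega)
  -- With `t + 1 = n / (8 * H)`, rounded down, `H * N` lies between `n / 8` and `n / 4`. So at least
  -- half of the vertices remain for the middle, and `2 ^ i ≤ t + 1` makes `N` large enough for one
  -- more level.
  set N := 2 * (t + 1) with hN
  have hrun := hm.mul hN (by rw [pow_succ]; omega)
  have hNH : n ≤ 8 * (H * N) := by rw [hN]; nlinarith
  have hNH' : 4 * (H * N) ≤ n := by rw [hN]; nlinarith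
  obtain ⟨arcs, ha, htime⟩ := hrun.exists_time (K := n - 2 * (H * N)) (by positivity) (by omega) σ
  refine ⟨arcs, i, ha, hi'.le, ?_⟩
  have hK : n ≤ 2 * (n - 2 * (H * N)) := by omega
  have hmN : H * N * 2 ^ i ≤ 2 * (m * (2 * N - 1)) := by
    calc H * N * 2 ^ i ≤ H * (2 ^ i + 1) * N := by nlinarith
      _ ≤ 2 * m * N := Nat.mul_le_mul_right _ hle
      _ = 2 * (m * N) := by ring
      _ ≤ 2 * (m * (2 * N - 1)) := by gcongr; omega
  calc n ^ 2 * 2 ^ i = n * 2 ^ i * n := by ring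
    _ ≤ 8 * (H * N) * 2 ^ i * (2 * (n - 2 * (H * N))) := by gcongr
    _ = 16 * (H * N * 2 ^ i) * (n - 2 * (H * N)) := by ring
    _ ≤ 16 * (2 * (m * (2 * N - 1))) * (n - 2 * (H * N)) := by gcongr
    _ = 32 * (m * (2 * N - 1) * (n - 2 * (H * N))) := by ring
    _ ≤ 32 * time σ arcs := by gcongr

end TopSearch

theorem mainTheorem7 :
    ∃ c : ℝ, 0 < c ∧ ∀ n : ℕ, 2 ≤ n → ∀ σ : Equiv.Perm (Fin n),
      ∃ arcs : List (Fin n × Fin n), TopSearch.IsAcyclicSequence arcs ∧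
        c * (n : ℝ) ^ 2 * (2 : ℝ) ^ Real.sqrt (2 * Real.logb 2 (n : ℝ)) ≤
          (TopSearch.time σ arcs : ℝ) := by
  -- The constant is `1 / (32 * 16)`, from `exists_le_time` and `two_pow_sqrt_le`. For `n < 8` the
  -- left side is then at most `64 * 16 / 512 = 2`, the cost of a single addition.
  refine ⟨1 / 512, by norm_num, fun n hn σ => ?_⟩
  rcases Nat.lt_or_ge n 8 with h8 | h8
  · obtain ⟨arcs, ha, ht⟩ := TopSearch.exists_two_le_time hn σ
    refine ⟨arcs, ha, ?_⟩
    have h1 := TopSearch.two_pow_sqrt_le (n := n) (i := 0) (by omega)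
      (by simp [TopSearch.triangle, Finset.sum_range_succ]; omega)
    have h2 : (n : ℝ) ^ 2 ≤ 64 := by
      have : (n : ℝ) ≤ 8 := by exact_mod_cast h8.le
      nlinarith [Nat.cast_nonneg (α := ℝ) n]
    have h3 : (2 : ℝ) ≤ TopSearch.time σ arcs := by exact_mod_cast ht
    have h4 : (n : ℝ) ^ 2 * (2 : ℝ) ^ √(2 * Real.logb 2 n) ≤ 64 * (16 * 2 ^ 0) := by gcongr
    linarith
  · obtain ⟨arcs, i, ha, hi, ht⟩ := TopSearch.exists_le_time h8 σ
    refine ⟨arcs, ha, ?_⟩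
    have h1 := TopSearch.two_pow_sqrt_le (by omega) hi
    have h2 : (n : ℝ) ^ 2 * 2 ^ i ≤ 32 * TopSearch.time σ arcs := by exact_mod_cast ht
    have h3 : (n : ℝ) ^ 2 * (2 : ℝ) ^ √(2 * Real.logb 2 n) ≤ (n : ℝ) ^ 2 * (16 * 2 ^ i) := by
      gcongr
    linarith
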